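/- Let $(R,\mathfrak m)$ be a Noetherian Cohen–Macaulay local ring of dimension $d\ge 1$ with infinite residue field, and let $I$ be an $\mathfrak m$-primary ideal of $R$ with $I\subseteq\mathfrak m^k$ for some integer $k\ge 2$. Let $e_0(I),\dots,e_d(I)$ be the Hilbert coefficients of $I$, that is, the (existing and unique) integers such that, for all sufficiently large $n$, $$\lambda(R/I^{n+1})=\sum_{j=0}^{d}(-1)^j e_j(I)\binom{n+d-j}{d-j},$$ where $\lambda$ denotes length. Then $$e_1(I)\le\binom{e_0(I)-k}{2},$$ where $\binom{m}{2}=m(m-1)/2$ for every integer $m$. -/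

import Mathlib

section Depth

variable (R : Type*) [CommRing R] [IsLocalRing R]

/-- The depth of a local ring `R`: the supremum of the lengths of the `R`-regular sequences
contained in the maximal ideal. -/
noncomputable def localDepth : ℕ∞ :=
  ⨆ rs : {rs : List R // (∀ r ∈ rs, r ∈ IsLocalRing.maximalIdeal R) ∧
    RingTheory.Sequence.IsRegular R rs}, (rs.1.length : ℕ∞)

/-- A Noetherian local ring is Cohen–Macaulay if its depth equals its Krull dimension. -/
def IsCohenMacaulayLocal [IsNoetherianRing R] : Prop :=
  (localDepth R : WithBot ℕ∞) = ringKrullDim R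

/-- Equivalently, some regular sequence in the maximal ideal has length `dim R`. -/
theorem isCohenMacaulayLocal_iff [IsNoetherianRing R] : IsCohenMacaulayLocal R ↔
    ∃ rs : List R, (∀ r ∈ rs, r ∈ IsLocalRing.maximalIdeal R) ∧
      RingTheory.Sequence.IsRegular R rs ∧ ((rs.length : ℕ∞) : WithBot ℕ∞) = ringKrullDim R := by
  unfold IsCohenMacaulayLocal localDepth
  constructor
  · intro h
    have hlt : ringKrullDim R < ⊤ := ringKrullDim_lt_top
    rw [← h] at hlt
    have hne : Nonempty {rs : List R // (∀ r ∈ rs, r ∈ IsLocalRing.maximalIdeal R) ∧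
        RingTheory.Sequence.IsRegular R rs} :=
      ⟨⟨[], by simp, by simp [RingTheory.Sequence.isRegular_iff]⟩⟩
    obtain ⟨rs, hrs⟩ := ENat.exists_eq_iSup_of_lt_top (WithBot.coe_lt_coe.mp hlt)
    exact ⟨rs.1, rs.2.1, rs.2.2, by rw [← h, ← hrs]⟩
  · rintro ⟨rs, hm, hr, hl⟩
    rw [← hl]
    congr 1
    apply le_antisymm
    · refine iSup_le fun ss => ?_
      have h1 := ringKrullDim_add_length_eq_ringKrullDim_of_isRegular ss.1 ss.2.2
      have hnt : Nontrivial (R ⧸ Ideal.ofList ss.1) := by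
        refine Ideal.Quotient.nontrivial_iff.mpr fun h => ss.2.2.top_ne_smul ?_
        simp [h]
      have h0 : (0 : WithBot ℕ∞) ≤ ringKrullDim (R ⧸ Ideal.ofList ss.1) :=
        ringKrullDim_nonneg_of_nontrivial
      have h2 : ((ss.1.length : ℕ∞) : WithBot ℕ∞) ≤ ((rs.length : ℕ∞) : WithBot ℕ∞) := by
        rw [hl, ← h1]
        exact le_add_of_nonneg_left h0
      exact WithBot.coe_le_coe.mp h2
    · exact le_iSup (fun ss : {rs : List R // (∀ r ∈ rs, r ∈ IsLocalRing.maximalIdeal R) ∧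
        RingTheory.Sequence.IsRegular R rs} => (ss.1.length : ℕ∞)) ⟨rs, hm, hr⟩

end Depth

section HilbertCoefficients

variable {R : Type*} [CommRing R]

/-- The integers `e 0, …, e d`, `d = dim R`, are the Hilbert coefficients of `I`:
for all large `n` the length of `R ⧸ I ^ (n + 1)` is finite and equal to
`∑ j ≤ d, (-1) ^ j * e j * binom (n + d - j) (d - j)`.
By convention the sequence is continued by `e j = 0` for `j > d`. -/
def IsHilbertCoefficients (I : Ideal R) (e : ℕ → ℤ) : Prop :=
  ∃ d : ℕ, ringKrullDim R = d ∧
    (∀ᶠ n : ℕ in Filter.atTop, ∃ l : ℕ, Module.length R (R ⧸ I ^ (n + 1)) = l ∧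
      (l : ℤ) = ∑ j ∈ Finset.range (d + 1),
        (-1) ^ j * e j * (Nat.choose (n + d - j) (d - j) : ℤ)) ∧
    ∀ j, d < j → e j = 0

theorem eq_zero_of_sum_choose_eq_zero (d : ℕ) (c : ℕ → ℤ) (N : ℕ)
    (h : ∀ n ≥ N, ∑ j ∈ Finset.range (d + 1), c j * (Nat.choose (n + d - j) (d - j) : ℤ) = 0) :
    ∀ j ≤ d, c j = 0 := by
  induction d generalizing N with
  | zero =>
    intro j hj
    obtain rfl : j = 0 := by omega
    simpa using h N le_rfl
  | succ d ih =>
    have key : ∀ j ≤ d, c j = 0 := by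
      apply ih (N + 1)
      intro m hm
      obtain ⟨n, rfl⟩ : ∃ n, m = n + 1 := ⟨m - 1, by omega⟩
      have h1 := h (n + 1) (by omega)
      have h2 := h n (by omega)
      rw [Finset.sum_range_succ] at h1 h2
      have h3 : ∑ j ∈ Finset.range (d + 1),
          c j * (Nat.choose (n + 1 + (d + 1) - j) (d + 1 - j) : ℤ) =
          ∑ j ∈ Finset.range (d + 1), c j * (Nat.choose (n + 1 + d - j) (d - j) : ℤ) +
          ∑ j ∈ Finset.range (d + 1), c j * (Nat.choose (n + (d + 1) - j) (d + 1 - j) : ℤ) := by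
        rw [← Finset.sum_add_distrib]
        refine Finset.sum_congr rfl fun j hj => ?_
        have hj' := Finset.mem_range.mp hj
        have e1 : n + 1 + (d + 1) - j = (n + 1 + d - j) + 1 := by omega
        have e2 : d + 1 - j = (d - j) + 1 := by omega
        have e3 : n + (d + 1) - j = n + 1 + d - j := by omega
        rw [e1, e2, e3, Nat.choose_succ_succ']
        push_cast
        ring
      simp only [Nat.sub_self, Nat.choose_zero_right] at h1 h2
      linarith
    intro j hj
    rcases Nat.lt_or_ge j (d + 1) with hlt | hge
    · exact key j (by omega)
    · obtain rfl : j = d + 1 := by omega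
      have h1 := h N le_rfl
      rw [Finset.sum_range_succ, Finset.sum_eq_zero] at h1
      · simpa using h1
      · intro i hi
        rw [key i (by have := Finset.mem_range.mp hi; omega), zero_mul]

/-- Hilbert coefficients are unique. -/
theorem IsHilbertCoefficients.unique {I : Ideal R} {e f : ℕ → ℤ}
    (he : IsHilbertCoefficients I e) (hf : IsHilbertCoefficients I f) : e = f := by
  obtain ⟨d, hd, he1, he2⟩ := he
  obtain ⟨d', hd', hf1, hf2⟩ := hf
  obtain rfl : d = d' := by
    rw [hd] at hd'
    exact_mod_cast hd'
  obtain ⟨N, hN⟩ := Filter.eventually_atTop.mp (he1.and hf1)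
  have h := eq_zero_of_sum_choose_eq_zero d (fun j => (-1) ^ j * (e j - f j)) N (by
    intro n hn
    obtain ⟨⟨l, hl, hle⟩, ⟨l', hl', hlf⟩⟩ := hN n hn
    obtain rfl : l = l' := by
      rw [hl] at hl'
      exact_mod_cast hl'
    have h0 := hle.symm.trans hlf
    rw [← sub_eq_zero, ← Finset.sum_sub_distrib] at h0
    rw [← h0]
    exact Finset.sum_congr rfl fun j _ => by ring)
  funext j
  rcases Nat.lt_or_ge d j with hj | hj
  · rw [he2 j hj, hf2 j hj]
  · have h1 := h j hj
    have h2 : ((-1 : ℤ)) ^ j ≠ 0 := pow_ne_zero _ (by norm_num)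
    have h3 := (mul_eq_zero.mp h1).resolve_left h2
    linarith

open Classical in
/-- The `j`-th Hilbert coefficient `e_j(I)` (with value `0` if `I` has no Hilbert coefficients). -/
noncomputable def hilbertCoefficient (I : Ideal R) (j : ℕ) : ℤ :=
  if h : ∃ e : ℕ → ℤ, IsHilbertCoefficients I e then h.choose j else 0

theorem IsHilbertCoefficients.hilbertCoefficient_eq {I : Ideal R} {e : ℕ → ℤ}
    (he : IsHilbertCoefficients I e) (j : ℕ) : hilbertCoefficient I j = e j := by
  have h : ∃ e : ℕ → ℤ, IsHilbertCoefficients I e := ⟨e, he⟩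
  rw [hilbertCoefficient, dif_pos h, h.choose_spec.unique he]

end HilbertCoefficients

/-! Write `H(i) = λ(I^i / I^(i+1))`. In dimension one `λ(R / I^(n+1)) = e₀(n+1) - e₁` for large `n`,
so `e₁` is the sum of the defects `e₀ - H(i)` over `i ≤ n`. Each defect is at most `max 0 (e₀ - k -
1 - i)`, and these bounds add up to at most `binom (e₀ - k) 2` (`sum_max_zero_le_choose_two`).

The bound on a defect rests on a dichotomy (`exists_span_mul_or_le_colength`). If `I^(i+1) = z I^i`,
then `H` is constant from `i` on, so the defect is zero. Otherwise filter `I^i` by the `𝔪^j I^i` for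
`j ≤ k`; the last one contains `I^(i+1)`. The first quotient has length at least `i + 1`, since
otherwise the Eakin–Sathaye theorem (`exists_pow_succ_eq_span_singleton_mul`) yields such a `z`.
Each of the other `k - 1` quotients has length at least 2, since otherwise some `𝔪^j I^i` with `j ≥
1` is principal and regular, hence `𝔪` and then `I` are principal. So `H(i) ≥ i + 2k - 1 ≥ i + k +
1`.

Higher dimension reduces to dimension one modulo a regular superficial element that starts a maximal
regular sequence (`exists_superficial_isRegular`). The quotient stays Cohen–Macaulay, the image of
`I` still lies in the `k`-th power of the maximal ideal, and every coefficient but the last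
survives. The same induction shows that the coefficients exist
(`exists_isHilbertCoefficients_of_quotient`). -/

section EakinSathaye

/-! ### Eakin–Sathaye for subspaces of an algebra over an infinite field -/

variable {K V : Type*} [Field K] [AddCommGroup V] [Module K V]

/-- A set of vectors that is nonempty and contains, on every line through one of its points,
all but finitely many points of the line. -/
def IsGenericSet (K : Type*) {V : Type*} [Field K] [AddCommGroup V] [Module K V]
    (U : Set V) : Prop :=
  U.Nonempty ∧ ∀ u ∈ U, ∀ v, {t : K | u + t • v ∉ U}.Finite

theorem isGenericSet_univ : IsGenericSet K (Set.univ : Set V) :=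
  ⟨⟨0, trivial⟩, fun _ _ _ => by simp⟩

/-- The line joining a point of `U` to a point of `U'` meets each complement in finitely many
points, so over an infinite field it has a point in both sets. -/
theorem IsGenericSet.inter [Infinite K] {U U' : Set V} (h : IsGenericSet K U)
    (h' : IsGenericSet K U') : IsGenericSet K (U ∩ U') := by
  constructor
  · obtain ⟨u, hu⟩ := h.1
    obtain ⟨u', hu'⟩ := h'.1
    have h1 := h.2 u hu (u' - u)
    have h2 := (h'.2 u' hu' (u - u')).preimage
      (f := fun t : K => 1 - t) (fun a _ b _ hab => by simpa using hab)
    obtain ⟨t, ht⟩ := (h1.union h2).infinite_compl.nonempty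
    simp only [Set.compl_union, Set.mem_inter_iff, Set.mem_compl_iff, Set.mem_ofPred_eq,
      Set.mem_preimage, not_not] at ht
    refine ⟨_, ht.1, ?_⟩
    have e : u + t • (u' - u) = u' + (1 - t) • (u - u') := by module
    rw [e]
    exact ht.2
  · rintro u ⟨hu, hu'⟩ v
    refine ((h.2 u hu v).union (h'.2 u hu' v)).subset fun t ht => ?_
    by_contra hn
    simp only [Set.mem_union, Set.mem_ofPred_eq, not_or, not_not] at hn
    exact ht hn

theorem IsGenericSet.biInter [Infinite K] {ι : Type*} (s : Finset ι) {U : ι → Set V}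
    (h : ∀ i ∈ s, IsGenericSet K (U i)) : IsGenericSet K (⋂ i ∈ s, U i) := by
  classical
  induction s using Finset.induction_on with
  | empty => simpa using isGenericSet_univ
  | insert a s ha ih =>
    rw [Finset.set_biInter_insert]
    exact (h a (by simp)).inter (ih fun i hi => h i (by simp [hi]))

/-- For such `t`, which is nonzero, `-1/t` is an eigenvalue of `B`, and there are only finitely
many. -/
theorem finite_setOf_not_isUnit_one_add_smul {N : Type*} [AddCommGroup N] [Module K N]
    [FiniteDimensional K N] (B : Module.End K N) :
    {t : K | ¬ IsUnit (1 + t • B)}.Finite := by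
  have h := (Module.End.finite_spectrum B).preimage (f := fun t : K => -t⁻¹)
    (fun a _ b _ hab => by simpa using hab)
  refine h.subset fun t ht => ?_
  have ht0 : t ≠ 0 := by
    rintro rfl
    simp at ht
  rw [Set.mem_preimage, spectrum.mem_iff]
  intro hu
  apply ht
  have e : 1 + t • B = algebraMap K (Module.End K N) (-t) *
      (algebraMap K (Module.End K N) (-t⁻¹) - B) := by
    rw [mul_sub, ← map_mul, neg_mul_neg, mul_inv_cancel₀ ht0, map_one, ← Algebra.smul_def, neg_smul]
    abel
  rw [e]
  exact ((IsUnit.mk0 (-t) (neg_ne_zero.mpr ht0)).map (algebraMap K (Module.End K N))).mul hu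

variable {A : Type*} [CommRing A] [Algebra K A]

theorem span_singleton_mul_span_singleton_eq (a b : A) :
    (K ∙ a) * (K ∙ b) = (K ∙ (a * b)) := by
  rw [Submodule.span_mul_span, Set.singleton_mul_singleton]

/-- Surjectivity of multiplication `M → N` is an open condition: if `s` is a section of
multiplication by `u`, then multiplication by `u + t v` composed with `s` is `1 + t B`, which is
invertible for almost all `t`. So one good element suffices for genericity. -/
theorem isGenericSet_setOf_le_span_mul {V M N : Submodule K A} [FiniteDimensional K N]
    (hVM : V * M ≤ N) {y : V} (hy : N ≤ (K ∙ (y : A)) * M) :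
    IsGenericSet K {z : V | N ≤ (K ∙ (z : A)) * M} := by
  refine ⟨⟨y, hy⟩, fun u hu v => ?_⟩
  have hmul (z : V) (m : M) : (z : A) * m ∈ N := hVM (Submodule.mul_mem_mul z.2 m.2)
  let f (z : V) : M →ₗ[K] N :=
    ((LinearMap.mulLeft K (z : A)).comp M.subtype).codRestrict N (hmul z)
  have hf (z : V) (m : M) : (f z m : A) = z * m := rfl
  have hsurj : Function.Surjective (f u) := by
    rintro ⟨n, hn⟩
    obtain ⟨m, hm, e⟩ := Submodule.mem_span_singleton_mul.mp (hu hn)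
    exact ⟨⟨m, hm⟩, Subtype.ext e⟩
  obtain ⟨s, hs⟩ := (f u).exists_rightInverse_of_surjective (LinearMap.range_eq_top.mpr hsurj)
  refine (finite_setOf_not_isUnit_one_add_smul ((f v).comp s)).subset fun t ht hunit => ht ?_
  intro n hn
  obtain ⟨n', hn'⟩ := ((Module.End.isUnit_iff _).mp hunit).2 ⟨n, hn⟩
  rw [Submodule.mem_span_singleton_mul]
  refine ⟨s n', (s n').2, ?_⟩
  have h1 := congrArg (fun x : N => (x : A)) hn'
  have h2 := congrArg (fun x : N => (x : A)) (LinearMap.congr_fun hs n')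
  simp only [LinearMap.add_apply, Module.End.one_apply, LinearMap.smul_apply, LinearMap.comp_apply,
    Submodule.coe_add, Submodule.coe_smul, hf, LinearMap.id_apply] at h1 h2
  rw [← h1, ← h2]
  simp only [Submodule.coe_add, Submodule.coe_smul, add_mul, smul_mul_assoc, h2]

/-- The case of one general element in the theorem of Eakin and Sathaye on reductions, for the
powers of a finite-dimensional subspace of an algebra over an infinite field. -/
theorem isGenericSet_of_finrank_mul_pow_le [Infinite K] (V : Submodule K A)
    [FiniteDimensional K V] (n : ℕ) (w : A)
    (h : Module.finrank K ↥((K ∙ w) * V ^ (n + 1)) ≤ n + 1) :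
    IsGenericSet K {z : V | (K ∙ w) * V ^ (n + 1) ≤ (K ∙ (z : A)) * ((K ∙ w) * V ^ n)} := by
  have hVfg : V.FG := V.fg_iff_finiteDimensional.mpr inferInstance
  have hfin (w : A) (n : ℕ) : FiniteDimensional K ↥((K ∙ w) * V ^ n) :=
    (Submodule.fg_iff_finiteDimensional _).mp
      ((Submodule.fg_span_singleton w).mul (hVfg.pow n))
  induction n generalizing w with
  | zero =>
    have := hfin w 1
    by_cases hex : ∃ y : V, (K ∙ w) * V ^ (0 + 1) ≤ (K ∙ (y : A)) * ((K ∙ w) * V ^ 0)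
    · obtain ⟨y, hy⟩ := hex
      exact isGenericSet_setOf_le_span_mul (by rw [pow_succ]; exact le_of_eq (by ring)) hy
    · exfalso
      push Not at hex
      have hzero : (K ∙ w) * V ^ (0 + 1) = ⊥ := by
        rw [eq_bot_iff, zero_add, pow_one, Submodule.mul_le]
        intro a ha y hy
        obtain ⟨c, rfl⟩ := Submodule.mem_span_singleton.mp ha
        by_contra hne
        apply hex ⟨y, hy⟩
        have hle : (K ∙ y) * ((K ∙ w) * V ^ 0) ≤ (K ∙ w) * V ^ (0 + 1) := by
          rw [zero_add, pow_one, pow_zero, mul_one, mul_comm]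
          gcongr
          simpa using hy
        have hpos : (K ∙ y) * ((K ∙ w) * V ^ 0) ≠ ⊥ := by
          intro hb
          apply hne
          rw [← hb, pow_zero, mul_one, mul_comm (c • w)]
          exact Submodule.mul_mem_mul (Submodule.mem_span_singleton_self y)
            (Submodule.smul_mem _ c (Submodule.mem_span_singleton_self w))
        have : FiniteDimensional K ↥((K ∙ y) * ((K ∙ w) * V ^ 0)) :=
          Submodule.finiteDimensional_of_le hle
        refine (Submodule.eq_of_le_of_finrank_le hle (h.trans ?_)).ge
        rw [zero_add, Nat.one_le_iff_ne_zero, Ne, Submodule.finrank_eq_zero]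
        exact hpos
      exact hex 0 (by rw [hzero]; exact bot_le)
  | succ n ih =>
    have := hfin w (n + 2)
    by_cases hex : ∃ y : V, (K ∙ w) * V ^ (n + 2) ≤ (K ∙ (y : A)) * ((K ∙ w) * V ^ (n + 1))
    · obtain ⟨y, hy⟩ := hex
      exact isGenericSet_setOf_le_span_mul (by rw [pow_succ _ (n + 1)]; exact le_of_eq (by ring)) hy
    · push Not at hex
      -- As no `y` works, `y w V^(n+1)` is a proper subspace of `w V^(n+2)`. The dimension drops and
      -- induction applies to the weight `y w`; this is why a weight is carried along.
      have key (y : V) : IsGenericSet K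
          {z : V | (K ∙ (y * w)) * V ^ (n + 1) ≤ (K ∙ (z : A)) * ((K ∙ (y * w)) * V ^ n)} := by
        apply ih
        have hle : (K ∙ ((y : A) * w)) * V ^ (n + 1) ≤ (K ∙ w) * V ^ (n + 2) := by
          rw [← span_singleton_mul_span_singleton_eq, pow_succ' _ (n + 1), mul_comm (K ∙ (y : A)), mul_assoc]
          gcongr
          simp
        have hlt : (K ∙ ((y : A) * w)) * V ^ (n + 1) < (K ∙ w) * V ^ (n + 2) := by
          refine lt_of_le_not_ge hle fun hge => hex y ?_
          rwa [← mul_assoc, span_singleton_mul_span_singleton_eq]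
        have := (Submodule.finrank_lt_finrank_of_lt hlt).trans_le h
        omega
      obtain ⟨s, hs⟩ := hVfg
      have hsV (y : A) (hy : y ∈ s) : y ∈ V := hs ▸ Submodule.subset_span hy
      -- A single `z` serves all generators `y` of `V`: `y w V^(n+1) ⊆ z y w V^n ⊆ z w V^(n+1)`, and
      -- summing over `y` contradicts nothing but gives the required inclusion.
      have hgen := IsGenericSet.biInter (V := V) (K := K) s.attach
        (U := fun y => {z : V | (K ∙ (y.1 * w)) * V ^ (n + 1) ≤
          (K ∙ (z : A)) * ((K ∙ (y.1 * w)) * V ^ n)}) fun y _ => key ⟨y.1, hsV y.1 y.2⟩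
      obtain ⟨z, hz⟩ := hgen.1
      refine isGenericSet_setOf_le_span_mul
        (by rw [pow_succ _ (n + 1)]; exact le_of_eq (by ring)) (y := z) ?_
      have e : (K ∙ w) * V ^ (n + 2) = V * ((K ∙ w) * V ^ (n + 1)) := by
        rw [pow_succ _ (n + 1)]; ring
      rw [e]
      nth_rw 1 [← hs]
      rw [Submodule.mul_le]
      intro a ha b hb
      have hle : Submodule.span K (s : Set A) ≤
          Submodule.comap (LinearMap.mulRight K b) ((K ∙ (z : A)) * ((K ∙ w) * V ^ (n + 1))) := by
        rw [Submodule.span_le]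
        intro y hy
        simp only [Set.mem_iInter] at hz
        have h1 := hz ⟨y, hy⟩ (Finset.mem_attach _ _)
        simp only [Set.mem_ofPred_eq, ← span_singleton_mul_span_singleton_eq] at h1
        have h2 : y * b ∈ (K ∙ y) * (K ∙ w) * V ^ (n + 1) := by
          rw [mul_assoc]
          exact Submodule.mul_mem_mul (Submodule.mem_span_singleton_self y) hb
        refine (?_ : _ ≤ (K ∙ (z : A)) * ((K ∙ w) * V ^ (n + 1))) (h1 h2)
        rw [pow_succ', mul_comm ((K ∙ y)), mul_assoc ((K ∙ w))]
        gcongr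
        simpa using hsV y hy
      exact hle ha

end EakinSathaye

/-! ### Lengths of quotients by ideals -/

section Colength

variable {R : Type*} [CommRing R]

theorem length_quotient_eq_add_of_le {N M : Ideal R} (h : N ≤ M) :
    Module.length R (R ⧸ N) =
      Module.length R (M ⧸ Submodule.comap M.subtype N) + Module.length R (R ⧸ M) := by
  refine Module.length_eq_add_of_exact (Submodule.mapQ _ N M.subtype le_rfl)
    (Submodule.factor h) ?_ (Submodule.factor_surjective h) ?_
  · rw [← LinearMap.ker_eq_bot, Submodule.ker_mapQ]
    simp
  · rw [LinearMap.exact_iff, Submodule.range_mapQ]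
    simp [Submodule.factor, Submodule.ker_mapQ]

/-- The colength of an ideal as a natural number, equal to `0` if it is infinite. -/
noncomputable def Ideal.colength (J : Ideal R) : ℕ := (Module.length R (R ⧸ J)).toNat

namespace Ideal

theorem coe_colength {J : Ideal R} (h : Module.length R (R ⧸ J) ≠ ⊤) :
    (J.colength : ℕ∞) = Module.length R (R ⧸ J) := ENat.natCast_toNat h

theorem length_quotient_ne_top_of_le {J J' : Ideal R} (hle : J ≤ J')
    (h : Module.length R (R ⧸ J) ≠ ⊤) : Module.length R (R ⧸ J') ≠ ⊤ :=
  ne_top_of_le_ne_top h (Module.length_le_of_surjective _ (Submodule.factor_surjective hle))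

theorem colength_le_of_le {J J' : Ideal R} (hle : J ≤ J')
    (h : Module.length R (R ⧸ J) ≠ ⊤) : J'.colength ≤ J.colength := by
  rw [← Nat.cast_le (α := ℕ∞), coe_colength h, coe_colength (length_quotient_ne_top_of_le hle h)]
  exact Module.length_le_of_surjective _ (Submodule.factor_surjective hle)

theorem colength_lt_of_lt {J J' : Ideal R} (hlt : J < J')
    (h : Module.length R (R ⧸ J) ≠ ⊤) : J'.colength < J.colength := by
  have h' := length_quotient_ne_top_of_le hlt.le h
  rw [← Nat.cast_lt (α := ℕ∞), coe_colength h, coe_colength h']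
  rw [Module.length_quotient] at h' ⊢
  rw [Module.length_quotient]
  exact Order.coheight_strictAnti hlt h'.lt_top

/-- Additivity of length on `0 → R/(J : z) → R/J → R/(J + (z)) → 0`, the first map being
multiplication by `z`. -/
theorem length_quotient_eq_comap_add (J : Ideal R) (z : R) :
    Module.length R (R ⧸ J) =
      Module.length R (R ⧸ (Submodule.comap (LinearMap.mulLeft R z) J : Ideal R)) +
        Module.length R (R ⧸ (J ⊔ span {z})) := by
  refine Module.length_eq_add_of_exact (Submodule.mapQ _ J (LinearMap.mulLeft R z) le_rfl)
    (Submodule.factor le_sup_left) ?_ (Submodule.factor_surjective _) ?_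
  · rw [← LinearMap.ker_eq_bot, Submodule.ker_mapQ, Submodule.mkQ_map_self]
  · rw [LinearMap.exact_iff, Submodule.range_mapQ, Submodule.factor, Submodule.ker_mapQ,
      Submodule.comap_id, Submodule.map_sup, Submodule.mkQ_map_self, bot_sup_eq]
    congr 1
    ext x
    simp [mem_span_singleton', mul_comm, LinearMap.mem_range]

theorem colength_eq_comap_add {J : Ideal R} (h : Module.length R (R ⧸ J) ≠ ⊤) (z : R) :
    J.colength = colength (Submodule.comap (LinearMap.mulLeft R z) J) +
      (J ⊔ span {z}).colength := by
  have e := length_quotient_eq_comap_add J z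
  rw [colength, e, ENat.toNat_add] <;> [rfl; skip; skip] <;>
  · intro ht
    rw [ht] at e
    simp at e
    exact h e

variable [IsLocalRing R] [IsNoetherianRing R]

theorem length_quotient_ne_top {J : Ideal R} {N : ℕ}
    (h : IsLocalRing.maximalIdeal R ^ N ≤ J) : Module.length R (R ⧸ J) ≠ ⊤ := by
  rw [Module.length_eq_of_surjective (S := R) (R := R ⧸ J) Ideal.Quotient.mk_surjective]
  by_cases hJ : J = ⊤
  · subst hJ
    have : Subsingleton (R ⧸ (⊤ : Ideal R)) := Ideal.Quotient.subsingleton_iff.mpr rfl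
    simp
  have : Nontrivial (R ⧸ J) := Ideal.Quotient.nontrivial_iff.mpr hJ
  have : IsLocalRing (R ⧸ J) := .of_surjective' (Ideal.Quotient.mk J) Ideal.Quotient.mk_surjective
  have hm : IsArtinianRing (R ⧸ J) := by
    rw [isArtinianRing_iff_isNilpotent_maximalIdeal]
    refine ⟨N, ?_⟩
    have e : IsLocalRing.maximalIdeal (R ⧸ J) =
        (IsLocalRing.maximalIdeal R).map (Ideal.Quotient.mk J) :=
      (IsLocalRing.map_maximalIdeal_of_surjective _ Ideal.Quotient.mk_surjective).symm
    rw [e, ← Ideal.map_pow]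
    exact le_bot_iff.mp ((Ideal.map_mono h).trans (Ideal.map_quotient_self J).le)
  exact Module.length_ne_top

/-- An ideal of the local ring with at most one generator is detected by colengths. -/
theorem exists_eq_span_singleton_of_colength_le {J : Ideal R}
    (h : Module.length R (R ⧸ (IsLocalRing.maximalIdeal R * J)) ≠ ⊤)
    (hle : (IsLocalRing.maximalIdeal R * J).colength ≤ J.colength + 1) :
    ∃ y, J = span {y} := by
  have hjac : IsLocalRing.maximalIdeal R ≤ jacobson ⊥ :=
    (IsLocalRing.jacobson_eq_maximalIdeal ⊥ bot_ne_top).ge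
  by_cases hex : J ≤ IsLocalRing.maximalIdeal R * J
  · refine ⟨0, ?_⟩
    rw [Submodule.eq_bot_of_le_smul_of_le_jacobson_bot _ J (IsNoetherian.noetherian J) hex hjac]
    simp
  · obtain ⟨y, hy, hy'⟩ := SetLike.not_le_iff_exists.mp hex
    refine ⟨y, le_antisymm ?_ ((span_singleton_le_iff_mem J).mpr hy)⟩
    have h1 : IsLocalRing.maximalIdeal R * J < span {y} ⊔ IsLocalRing.maximalIdeal R * J := by
      refine lt_of_le_not_ge le_sup_right fun hge => hy' (hge ?_)
      exact mem_sup_left (mem_span_singleton_self y)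
    have h2 : span {y} ⊔ IsLocalRing.maximalIdeal R * J ≤ J :=
      sup_le ((span_singleton_le_iff_mem J).mpr hy) Ideal.mul_le_right
    have h3 := colength_lt_of_lt h1 h
    have h4 : span {y} ⊔ IsLocalRing.maximalIdeal R * J = J := by
      by_contra hne
      have := colength_lt_of_lt (lt_of_le_of_ne h2 hne) (length_quotient_ne_top_of_le h1.le h)
      omega
    exact Submodule.le_of_le_smul_of_le_jacobson_bot (IsNoetherian.noetherian J) hjac h4.ge

end Ideal

end Colength

/-! ### Graded components of ideals extended to the Rees algebra -/

section ReesAlgebra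

open Polynomial

variable {R : Type*} [CommRing R] {I : Ideal R}

/-- The extension of `J` is the graded ideal `⊕ J I^n t^n`; this is the inclusion that recovers
information in `R` from the Rees algebra. -/
theorem coeff_mem_of_mem_map_reesAlgebra {J : Ideal R} {p : reesAlgebra I}
    (hp : p ∈ J.map (algebraMap R (reesAlgebra I))) (n : ℕ) :
    (p : R[X]).coeff n ∈ J * I ^ n := by
  induction hp using Submodule.span_induction generalizing n with
  | mem p hp =>
    obtain ⟨r, hr, rfl⟩ := hp
    rw [show ((algebraMap R (reesAlgebra I) r : reesAlgebra I) : R[X]) = C r from rfl, coeff_C]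
    split_ifs with h
    · subst h
      simpa using hr
    · exact zero_mem _
  | zero => simp
  | add p q _ _ hp hq => simpa using add_mem (hp n) (hq n)
  | smul q p _ hp =>
    rw [smul_eq_mul, Subalgebra.coe_mul, coeff_mul]
    refine sum_mem fun x hx => ?_
    rw [← Finset.HasAntidiagonal.mem_antidiagonal.mp hx, pow_add, mul_left_comm]
    exact Ideal.mul_mem_mul (q.2 x.1) (hp x.2)

variable (I) in
/-- The inclusion of `I ^ n` in the Rees algebra as its component of degree `n`. -/
noncomputable def reesAlgebraMonomial (n : ℕ) : ↥(I ^ n) →ₗ[R] reesAlgebra I :=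
  LinearMap.codRestrict (Subalgebra.toSubmodule (reesAlgebra I))
    ((monomial n).comp (I ^ n).subtype) fun a => reesAlgebra.monomial_mem.mpr a.2

theorem coe_reesAlgebraMonomial (n : ℕ) (a : ↥(I ^ n)) :
    (reesAlgebraMonomial I n a : R[X]) = monomial n (a : R) := rfl

theorem reesAlgebraMonomial_mul {i j n : ℕ} (h : i + j = n) (a : ↥(I ^ i)) (b : ↥(I ^ j)) :
    reesAlgebraMonomial I i a * reesAlgebraMonomial I j b =
      reesAlgebraMonomial I n
        ⟨a * b, by subst h; rw [pow_add]; exact Ideal.mul_mem_mul a.2 b.2⟩ := by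
  subst h
  exact Subtype.ext (by simp [coe_reesAlgebraMonomial, monomial_mul_monomial])

theorem reesAlgebraMonomial_mem_map {J : Ideal R} {n : ℕ} {a : ↥(I ^ n)}
    (h : (a : R) ∈ J * I ^ n) :
    reesAlgebraMonomial I n a ∈ J.map (algebraMap R (reesAlgebra I)) := by
  obtain ⟨a, ha⟩ := a
  simp only at h
  induction h using Submodule.mul_induction_on' with
  | mem_mul_mem r hr b hb =>
    have e : reesAlgebraMonomial I n ⟨r * b, ha⟩ = r • reesAlgebraMonomial I n ⟨b, hb⟩ := by
      rw [← map_smul]; rfl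
    rw [e, Algebra.smul_def]
    exact Ideal.mul_mem_right _ _ (Ideal.mem_map_of_mem _ hr)
  | add x hx y hy h1 h2 =>
    have hx' := Ideal.mul_le_right hx
    have hy' := Ideal.mul_le_right hy
    have e : reesAlgebraMonomial I n ⟨x + y, ha⟩ =
        reesAlgebraMonomial I n ⟨x, hx'⟩ + reesAlgebraMonomial I n ⟨y, hy'⟩ := by
      rw [← map_add]; rfl
    rw [e]
    exact add_mem (h1 hx') (h2 hy')

theorem mem_of_reesAlgebraMonomial_mem_map {J : Ideal R} {n : ℕ} {a : ↥(I ^ n)}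
    (h : reesAlgebraMonomial I n a ∈ J.map (algebraMap R (reesAlgebra I))) :
    (a : R) ∈ J * I ^ n := by
  simpa [coe_reesAlgebraMonomial] using coeff_mem_of_mem_map_reesAlgebra h n

/-- The component of degree `n` of the Rees algebra is generated by products of `n` elements
of degree one. -/
theorem reesAlgebraMonomial_mem_pow {T : Ideal (reesAlgebra I)}
    (hT : ∀ a, reesAlgebraMonomial I 1 a ∈ T) (n : ℕ) (a : ↥(I ^ n)) :
    reesAlgebraMonomial I n a ∈ T ^ n := by
  induction n with
  | zero => simp
  | succ n ih =>
    obtain ⟨a, ha⟩ := a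
    have ha' := ha
    rw [pow_succ'] at ha'
    induction ha' using Submodule.mul_induction_on' with
    | mem_mul_mem x hx y hy =>
      have h := reesAlgebraMonomial_mul (add_comm 1 n) ⟨x, by simpa using hx⟩ ⟨y, hy⟩
      rw [← h, pow_succ' T]
      exact Ideal.mul_mem_mul (hT _) (ih _)
    | add x hx y hy h1 h2 =>
      rw [← pow_succ'] at hx hy
      have e : reesAlgebraMonomial I (n + 1) ⟨x + y, ha⟩ =
          reesAlgebraMonomial I (n + 1) ⟨x, hx⟩ + reesAlgebraMonomial I (n + 1) ⟨y, hy⟩ := by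
        rw [← map_add]; rfl
      rw [e]
      exact add_mem (h1 hx) (h2 hy)

end ReesAlgebra

/-! ### The fiber cone and principal reductions -/

section FiberCone

open IsLocalRing

variable {R : Type*} [CommRing R] [IsLocalRing R] (I : Ideal R)

/-- The fiber cone of an ideal of a local ring: the Rees algebra modulo the maximal ideal. -/
def FiberCone : Type _ :=
  (reesAlgebra I) ⧸ (maximalIdeal R).map (algebraMap R (reesAlgebra I))

noncomputable instance : CommRing (FiberCone I) :=
  inferInstanceAs (CommRing (_ ⧸ (maximalIdeal R).map (algebraMap R (reesAlgebra I))))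

/-- The projection from the Rees algebra to the fiber cone. -/
noncomputable def FiberCone.mk : reesAlgebra I →+* FiberCone I :=
  Ideal.Quotient.mk ((maximalIdeal R).map (algebraMap R (reesAlgebra I)))

theorem FiberCone.mk_eq_zero_iff {p : reesAlgebra I} :
    FiberCone.mk I p = 0 ↔ p ∈ (maximalIdeal R).map (algebraMap R (reesAlgebra I)) :=
  Ideal.Quotient.eq_zero_iff_mem

noncomputable instance : Algebra R (FiberCone I) :=
  ((FiberCone.mk I).comp (algebraMap R (reesAlgebra I))).toAlgebra

noncomputable instance : Algebra (ResidueField R) (FiberCone I) :=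
  RingHom.toAlgebra (Ideal.Quotient.lift (maximalIdeal R) (algebraMap R (FiberCone I))
    fun _ hr => (FiberCone.mk_eq_zero_iff I).mpr (Ideal.mem_map_of_mem _ hr))

instance : IsScalarTower R (ResidueField R) (FiberCone I) :=
  IsScalarTower.of_algebraMap_eq fun _ => rfl

/-- The map from `I ^ n` to the component of degree `n` of the fiber cone. -/
noncomputable def fiberConeMk (n : ℕ) : ↥(I ^ n) →ₗ[R] FiberCone I where
  toFun a := FiberCone.mk I (reesAlgebraMonomial I n a)
  map_add' a b := by rw [map_add, map_add]
  map_smul' r a := by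
    rw [map_smul, Algebra.smul_def, map_mul, RingHom.id_apply, Algebra.smul_def]
    rfl

variable {I}

theorem fiberConeMk_apply (n : ℕ) (a : ↥(I ^ n)) :
    fiberConeMk I n a = FiberCone.mk I (reesAlgebraMonomial I n a) := rfl

theorem fiberConeMk_mul {i j n : ℕ} (h : i + j = n) (a : ↥(I ^ i)) (b : ↥(I ^ j)) :
    fiberConeMk I i a * fiberConeMk I j b =
      fiberConeMk I n ⟨a * b, by subst h; rw [pow_add]; exact Ideal.mul_mem_mul a.2 b.2⟩ := by
  rw [fiberConeMk_apply, fiberConeMk_apply, fiberConeMk_apply, ← map_mul,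
    reesAlgebraMonomial_mul h]

theorem fiberConeMk_eq_zero_iff {n : ℕ} {a : ↥(I ^ n)} :
    fiberConeMk I n a = 0 ↔ (a : R) ∈ maximalIdeal R * I ^ n := by
  rw [fiberConeMk_apply, FiberCone.mk_eq_zero_iff]
  exact ⟨mem_of_reesAlgebraMonomial_mem_map, reesAlgebraMonomial_mem_map⟩

variable (I) in
/-- The component of degree one of the fiber cone. -/
noncomputable def fiberConeOne : Submodule (ResidueField R) (FiberCone I) :=
  Submodule.span (ResidueField R) (Set.range (fiberConeMk I 1))

variable (I) in
theorem exists_fiberConeMk_eq_of_mem_span (n : ℕ) {b : FiberCone I}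
    (hb : b ∈ Submodule.span (ResidueField R) (Set.range (fiberConeMk I n))) :
    ∃ a, fiberConeMk I n a = b := by
  induction hb using Submodule.span_induction with
  | mem b hb => exact hb
  | zero => exact ⟨0, map_zero _⟩
  | add x y _ _ hx hy =>
    obtain ⟨a, rfl⟩ := hx
    obtain ⟨b, rfl⟩ := hy
    exact ⟨a + b, map_add _ _ _⟩
  | smul c x _ hx =>
    obtain ⟨a, rfl⟩ := hx
    obtain ⟨r, rfl⟩ := residue_surjective c
    exact ⟨r • a, by rw [map_smul]; exact (algebraMap_smul (ResidueField R) r _).symm⟩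

/-- Together with `fiberConeMk_mem`, this identifies the `n`-th power of the degree-one component
with the image of `I^n`. -/
theorem exists_fiberConeMk_eq {n : ℕ} {b : FiberCone I} (hb : b ∈ fiberConeOne I ^ n) :
    ∃ a, fiberConeMk I n a = b := by
  induction n generalizing b with
  | zero =>
    rw [pow_zero] at hb
    obtain ⟨c, rfl⟩ := Submodule.mem_one.mp hb
    obtain ⟨r, rfl⟩ := residue_surjective c
    refine ⟨⟨r, by simp⟩, ?_⟩
    rfl
  | succ n ih =>
    apply exists_fiberConeMk_eq_of_mem_span
    rw [pow_succ'] at hb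
    induction hb using Submodule.mul_induction_on' with
    | mem_mul_mem x hx y hy =>
      obtain ⟨a, rfl⟩ := exists_fiberConeMk_eq_of_mem_span I 1 hx
      obtain ⟨b, rfl⟩ := ih hy
      rw [fiberConeMk_mul (add_comm 1 n)]
      exact Submodule.subset_span ⟨_, rfl⟩
    | add x _ y _ h1 h2 => exact add_mem h1 h2

theorem fiberConeMk_mem (n : ℕ) (a : ↥(I ^ n)) : fiberConeMk I n a ∈ fiberConeOne I ^ n := by
  induction n with
  | zero =>
    refine (pow_zero (fiberConeOne I)).symm ▸ Submodule.mem_one.mpr ?_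
    exact ⟨residue R a, rfl⟩
  | succ n ih =>
    obtain ⟨a, ha⟩ := a
    have ha' := ha
    rw [pow_succ'] at ha'
    induction ha' using Submodule.mul_induction_on' with
    | mem_mul_mem x hx y hy =>
      have h := fiberConeMk_mul (add_comm 1 n) ⟨x, by simpa using hx⟩ ⟨y, hy⟩
      rw [← h, pow_succ' (fiberConeOne I)]
      exact Submodule.mul_mem_mul (Submodule.subset_span ⟨_, rfl⟩) (ih _)
    | add x hx y hy h1 h2 =>
      rw [← pow_succ'] at hx hy
      have e : fiberConeMk I (n + 1) ⟨x + y, ha⟩ =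
          fiberConeMk I (n + 1) ⟨x, hx⟩ + fiberConeMk I (n + 1) ⟨y, hy⟩ := by
        rw [← map_add]; rfl
      rw [e]
      exact add_mem (h1 hx) (h2 hy)

variable [IsNoetherianRing R]

variable (I) in
theorem fg_fiberConeOne : (fiberConeOne I).FG := by
  obtain ⟨s, hs⟩ := IsNoetherian.noetherian (⊤ : Submodule R ↥(I ^ 1))
  classical
  refine ⟨s.image (fiberConeMk I 1), ?_⟩
  rw [fiberConeOne, Finset.coe_image]
  refine le_antisymm (Submodule.span_mono (Set.image_subset_range _ _)) ?_
  rw [Submodule.span_le]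
  rintro _ ⟨a, rfl⟩
  have ha : a ∈ Submodule.span R (s : Set ↥(I ^ 1)) := by rw [hs]; trivial
  have h1 : fiberConeMk I 1 a ∈ (Submodule.span R (s : Set ↥(I ^ 1))).map (fiberConeMk I 1) :=
    Submodule.mem_map_of_mem ha
  rw [Submodule.map_span] at h1
  exact Submodule.span_le_restrictScalars R (ResidueField R) _ h1

/-- `I^n / 𝔪 I^n` surjects onto the degree-`n` component of the fiber cone. Equality also holds, but
only this direction is needed to bound the dimension by the number of generators. -/
theorem finrank_fiberConeOne_pow_le {n : ℕ}
    (h : Module.length R (R ⧸ (maximalIdeal R * I ^ n)) ≠ ⊤) :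
    Module.finrank (ResidueField R) ↥(fiberConeOne I ^ n) + (I ^ n).colength ≤
      (maximalIdeal R * I ^ n).colength := by
  have hfin : Module.Finite (ResidueField R) ↥(fiberConeOne I ^ n) :=
    Module.Finite.iff_fg.mpr ((fg_fiberConeOne I).pow n)
  have hle : maximalIdeal R * I ^ n ≤ I ^ n := Ideal.mul_le_right
  rw [← Nat.cast_le (α := ℕ∞), Nat.cast_add, Ideal.coe_colength h,
    Ideal.coe_colength (Ideal.length_quotient_ne_top_of_le hle h),
    length_quotient_eq_add_of_le hle, ← Module.length_eq_finrank,
    ← Module.length_eq_of_surjective (S := R) (R := ResidueField R) residue_surjective]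
  gcongr
  let f : ↥(I ^ n) →ₗ[R] ↥(fiberConeOne I ^ n) :=
    LinearMap.codRestrict ((fiberConeOne I ^ n).restrictScalars R) (fiberConeMk I n)
      (fiberConeMk_mem n)
  have hf : Submodule.comap (I ^ n).subtype (maximalIdeal R * I ^ n) ≤ LinearMap.ker f := by
    intro a ha
    exact Subtype.ext (fiberConeMk_eq_zero_iff.mpr ha)
  refine Module.length_le_of_surjective (Submodule.liftQ _ f hf) ?_
  rw [← LinearMap.range_eq_top, Submodule.range_liftQ, LinearMap.range_eq_top]
  rintro ⟨b, hb⟩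
  obtain ⟨a, rfl⟩ := exists_fiberConeMk_eq hb
  exact ⟨a, rfl⟩

/-- The case of principal reductions in the theorem of Eakin and Sathaye: if `I ^ (n + 1)` has at
most `n + 1` generators, then it is equal to `z * I ^ n` for some `z` in `I`. -/
theorem exists_pow_succ_eq_span_singleton_mul [Infinite (ResidueField R)] {n : ℕ}
    (h : Module.length R (R ⧸ (maximalIdeal R * I ^ (n + 1))) ≠ ⊤)
    (hle : (maximalIdeal R * I ^ (n + 1)).colength ≤ (I ^ (n + 1)).colength + (n + 1)) :
    ∃ z ∈ I, I ^ (n + 1) = Ideal.span {z} * I ^ n := by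
  have hfd : FiniteDimensional (ResidueField R) (fiberConeOne I) :=
    Module.Finite.iff_fg.mpr (fg_fiberConeOne I)
  have h1 := finrank_fiberConeOne_pow_le h
  have e1 : Submodule.span (ResidueField R) {(1 : FiberCone I)} = 1 := Submodule.one_eq_span.symm
  obtain ⟨⟨z, hz⟩, hz'⟩ := (isGenericSet_of_finrank_mul_pow_le (fiberConeOne I) n (1 : FiberCone I) (by
    rw [e1, one_mul]; omega)).1
  rw [Set.mem_ofPred_eq, e1, one_mul, one_mul] at hz'
  obtain ⟨⟨a, ha⟩, rfl⟩ := exists_fiberConeMk_eq_of_mem_span I 1 hz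
  have haI : a ∈ I := by simpa using ha
  have hle' : Ideal.span {a} * I ^ n ≤ I ^ (n + 1) := by
    rw [pow_succ']
    exact Ideal.mul_mono_left ((Ideal.span_singleton_le_iff_mem I).mpr haI)
  refine ⟨a, haI, le_antisymm ?_ hle'⟩
  -- By Nakayama it suffices to work modulo `𝔪 I^(n+1)`, that is, in the fiber cone.
  refine Submodule.le_of_le_smul_of_le_jacobson_bot (I := maximalIdeal R)
    (IsNoetherian.noetherian _) (jacobson_eq_maximalIdeal ⊥ bot_ne_top).ge ?_
  intro b hb
  have h2 := hz' (fiberConeMk_mem (n + 1) ⟨b, hb⟩)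
  obtain ⟨c, hc, h3⟩ := Submodule.mem_span_singleton_mul.mp h2
  obtain ⟨⟨c, hc'⟩, rfl⟩ := exists_fiberConeMk_eq hc
  rw [fiberConeMk_mul (add_comm 1 n), eq_comm, ← sub_eq_zero, ← map_sub] at h3
  have h4 := fiberConeMk_eq_zero_iff.mp h3
  have e : b = a * c + (b - a * c) := by ring
  rw [e]
  exact Submodule.add_mem_sup
    (Ideal.mul_mem_mul (Ideal.mem_span_singleton_self a) hc') h4

end FiberCone

/-! ### The bound in dimension one -/

section DimensionOne

open IsLocalRing

theorem two_mul_ringChoose_two (m : ℤ) : 2 * Ring.choose m 2 = m * (m - 1) := by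
  have h := Ring.descPochhammer_eq_factorial_smul_choose m 2
  simp only [descPochhammer_succ_right, descPochhammer_zero, Polynomial.smeval_mul,
    Polynomial.smeval_sub, Polynomial.smeval_X, Polynomial.smeval_one, Nat.cast_zero,
    Nat.cast_one, sub_zero, Nat.factorial] at h
  simp at h
  linarith

/-- For `m > 0` this is a truncation of `(m-1) + (m-2) + ⋯`; for `m ≤ 0` every term vanishes while
`m(m-1)/2 ≥ 0`. -/
theorem sum_max_zero_le_choose_two (M : ℕ) (m : ℤ) :
    ∑ i ∈ Finset.range M, max 0 (m - 1 - i) ≤ Ring.choose m 2 := by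
  have h (M : ℕ) : ∀ m : ℤ, 2 * ∑ i ∈ Finset.range M, max 0 (m - 1 - i) ≤ m * (m - 1) := by
    induction M with
    | zero =>
      intro m
      rw [Finset.sum_range_zero, mul_zero]
      rcases le_or_gt m 0 with hm | hm <;> nlinarith
    | succ M ih =>
      intro m
      rcases le_or_gt m 0 with hm | hm
      · rw [Finset.sum_eq_zero fun i _ => max_eq_left (by omega)]
        nlinarith
      · rw [Finset.sum_range_succ']
        have h1 := ih (m - 1)
        have h2 : ∑ i ∈ Finset.range M, max 0 (m - 1 - ((i + 1 : ℕ) : ℤ)) =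
            ∑ i ∈ Finset.range M, max 0 (m - 1 - 1 - (i : ℤ)) :=
          Finset.sum_congr rfl fun i _ => by push_cast; ring_nf
        rw [h2, max_eq_right (by push_cast; omega)]
        push_cast
        linarith
  have h1 := h M m
  have h2 := two_mul_ringChoose_two m
  linarith

variable {R : Type*} [CommRing R]

theorem Ideal.colength_span_singleton_mul {z : R} (hz : z ∈ nonZeroDivisors R) {J : Ideal R}
    (h : Module.length R (R ⧸ (Ideal.span {z} * J)) ≠ ⊤) :
    (Ideal.span {z} * J).colength = J.colength + (Ideal.span {z}).colength := by
  rw [Ideal.colength_eq_comap_add h z, sup_eq_right.mpr Ideal.mul_le_left]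
  congr 2
  ext a
  rw [Submodule.mem_comap, LinearMap.mulLeft_apply, Ideal.mem_span_singleton_mul]
  constructor
  · rintro ⟨b, hb, e⟩
    rwa [← mul_cancel_left_mem_nonZeroDivisors hz |>.mp e]
  · exact fun ha => ⟨a, ha, rfl⟩

theorem mem_nonZeroDivisors_of_mem_of_le_span {x z : R} {J : Ideal R}
    (hx : x ∈ nonZeroDivisors R) (hxJ : x ∈ J) (h : J ≤ Ideal.span {z}) :
    z ∈ nonZeroDivisors R := by
  obtain ⟨a, rfl⟩ := Ideal.mem_span_singleton'.mp (h hxJ)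
  exact (mul_mem_nonZeroDivisors.mp hx).2

variable [IsLocalRing R] [IsNoetherianRing R]

/-- If a product of an ideal with the maximal ideal is principal and regular, then the maximal
ideal is principal. -/
theorem exists_maximalIdeal_eq_span_of_mul_eq_span {J : Ideal R} {y : R}
    (hy : y ∈ nonZeroDivisors R) (h : maximalIdeal R * J = Ideal.span {y}) :
    ∃ a, maximalIdeal R = Ideal.span {a} := by
  -- If every product lay in `𝔪 y`, Nakayama would give `y = 0`. Hence some `a b` is a unit times
  -- `y`; comparing `c b` with `a b` and cancelling `b` shows that `a` divides every `c` in `𝔪`.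
  have key : ∃ a ∈ maximalIdeal R, ∃ b ∈ J, a * b ∉ maximalIdeal R * Ideal.span {y} := by
    by_contra! hcon
    have h1 : Ideal.span {y} ≤ maximalIdeal R * Ideal.span {y} := by
      nth_rw 1 [← h]
      exact Ideal.mul_le.mpr hcon
    have h2 := Submodule.eq_bot_of_le_smul_of_le_jacobson_bot (maximalIdeal R) (Ideal.span {y})
      (IsNoetherian.noetherian _) h1 (jacobson_eq_maximalIdeal ⊥ bot_ne_top).ge
    rw [Ideal.span_singleton_eq_bot] at h2
    subst h2
    exact zero_notMem_nonZeroDivisors hy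
  obtain ⟨a, ha, b, hb, hab⟩ := key
  obtain ⟨u, hu⟩ := Ideal.mem_span_singleton'.mp (h ▸ Ideal.mul_mem_mul ha hb)
  have hunit : IsUnit u := by
    by_contra hnu
    exact hab (hu ▸ Ideal.mul_mem_mul ((mem_maximalIdeal u).mpr hnu)
      (Ideal.mem_span_singleton_self y))
  have hreg : a * b ∈ nonZeroDivisors R :=
    hu ▸ mul_mem hunit.mem_nonZeroDivisors hy
  refine ⟨a, le_antisymm (fun c hc => ?_) ((Ideal.span_singleton_le_iff_mem _).mpr ha)⟩
  obtain ⟨v, hv⟩ := Ideal.mem_span_singleton'.mp (h ▸ Ideal.mul_mem_mul hc hb)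
  obtain ⟨u', hu'⟩ := hunit.exists_right_inv
  rw [Ideal.mem_span_singleton']
  refine ⟨v * u', ?_⟩
  rw [← mul_cancel_right_mem_nonZeroDivisors (mul_mem_nonZeroDivisors.mp hreg).2]
  linear_combination hv + v * y * hu' - v * u' * hu

/-- By Krull's intersection theorem there is a largest `s` with `I ⊆ 𝔪^s = (a^s)`; an element of `I`
outside `𝔪^(s+1)` is a unit times `a^s`. -/
theorem exists_eq_span_singleton_of_maximalIdeal_eq_span {a : R}
    (ha : maximalIdeal R = Ideal.span {a}) {I : Ideal R} (hI : I ≠ ⊥) :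
    ∃ z, I = Ideal.span {z} := by
  have hex : ∃ s, ¬ I ≤ maximalIdeal R ^ s := by
    by_contra! hcon
    apply hI
    rw [eq_bot_iff, ← Ideal.iInf_pow_eq_bot_of_isLocalRing (maximalIdeal R) Ideal.IsPrime.ne_top']
    exact le_iInf hcon
  classical
  obtain ⟨s, hs⟩ : ∃ s, Nat.find hex = s + 1 :=
    Nat.exists_eq_succ_of_ne_zero fun h0 => Nat.find_spec hex (by rw [h0]; simp)
  have h1 : I ≤ maximalIdeal R ^ s := by
    have := Nat.find_min hex (m := s) (by omega)
    rwa [not_not] at this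
  have h2 : ¬ I ≤ maximalIdeal R ^ (s + 1) := hs ▸ Nat.find_spec hex
  rw [ha, Ideal.span_singleton_pow] at h1 h2
  refine ⟨a ^ s, le_antisymm h1 ?_⟩
  obtain ⟨b, hb, hb'⟩ := SetLike.not_le_iff_exists.mp h2
  obtain ⟨u, rfl⟩ := Ideal.mem_span_singleton'.mp (h1 hb)
  have hu : IsUnit u := by
    by_contra hnu
    apply hb'
    obtain ⟨c, rfl⟩ := Ideal.mem_span_singleton'.mp (ha ▸ (mem_maximalIdeal u).mpr hnu)
    exact Ideal.mem_span_singleton'.mpr ⟨c, by ring⟩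
  rw [Ideal.span_singleton_le_iff_mem]
  exact (Ideal.unit_mul_mem_iff_mem I hu).mp hb

theorem length_quotient_pow_mul_pow_ne_top {I : Ideal R} {N : ℕ} (hN : maximalIdeal R ^ N ≤ I)
    (i j : ℕ) : Module.length R (R ⧸ (maximalIdeal R ^ j * I ^ i)) ≠ ⊤ := by
  apply Ideal.length_quotient_ne_top (N := j + N * i)
  rw [pow_add, pow_mul]
  gcongr

theorem length_quotient_pow_ne_top {I : Ideal R} {N : ℕ} (hN : maximalIdeal R ^ N ≤ I)
    (i : ℕ) : Module.length R (R ⧸ I ^ i) ≠ ⊤ := by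
  have h := length_quotient_pow_mul_pow_ne_top hN i 0
  rwa [pow_zero, one_mul] at h

/-- The relation propagates to `I^(i+t+1) = z I^(i+t)`. Since `z` divides the regular element
`x^(i+1)`, it is regular, so each of these differences is `λ(R/(z))`. -/
theorem colength_pow_succ_sub_of_eq_span_mul {I : Ideal R} {N : ℕ} (hN : maximalIdeal R ^ N ≤ I)
    {x : R} (hx : x ∈ nonZeroDivisors R) (hxI : x ∈ I) {i : ℕ} {z : R}
    (hz : I ^ (i + 1) = Ideal.span {z} * I ^ i) (t : ℕ) :
    ((I ^ (i + t + 1)).colength : ℤ) - (I ^ (i + t)).colength =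
      (I ^ (i + 1)).colength - (I ^ i).colength := by
  have hzreg : z ∈ nonZeroDivisors R :=
    mem_nonZeroDivisors_of_mem_of_le_span (pow_mem hx (i + 1)) (Ideal.pow_mem_pow hxI _)
      (hz.le.trans Ideal.mul_le_left)
  have key (t : ℕ) : (I ^ (i + t + 1)).colength =
      (I ^ (i + t)).colength + (Ideal.span {z}).colength := by
    have e : I ^ (i + t + 1) = Ideal.span {z} * I ^ (i + t) := by
      rw [show i + t + 1 = (i + 1) + t by ring, pow_add, hz, pow_add, mul_assoc]
    rw [e]
    exact Ideal.colength_span_singleton_mul hzreg (e ▸ length_quotient_pow_ne_top hN _)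
  have h0 := key 0
  rw [key t]
  rw [add_zero] at h0
  rw [h0]
  push_cast
  ring

/-- Either `I ^ (i + 1) = z * I ^ i` for some `z`, or the Hilbert function of `I` at `i`
is at least `i + k + 1`. -/
theorem exists_span_mul_or_le_colength [Infinite (ResidueField R)] {I : Ideal R} {N : ℕ}
    (hN : maximalIdeal R ^ N ≤ I) {x : R} (hx : x ∈ nonZeroDivisors R) (hxI : x ∈ I)
    {k : ℕ} (hk : 2 ≤ k) (hIk : I ≤ maximalIdeal R ^ k) (i : ℕ) :
    (∃ z, I ^ (i + 1) = Ideal.span {z} * I ^ i) ∨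
      (I ^ i).colength + i + k + 1 ≤ (I ^ (i + 1)).colength := by
  have hxm : x ∈ maximalIdeal R := Ideal.pow_le_self (by omega) (hIk hxI)
  by_cases hprin : ∃ a, maximalIdeal R = Ideal.span {a}
  · left
    obtain ⟨a, ha⟩ := hprin
    have hI0 : I ≠ ⊥ := by
      rintro rfl
      exact zero_notMem_nonZeroDivisors ((Ideal.mem_bot.mp hxI) ▸ hx)
    obtain ⟨z, hz⟩ := exists_eq_span_singleton_of_maximalIdeal_eq_span ha hI0
    exact ⟨z, by rw [pow_succ', ← hz]⟩
  by_cases hred : ∃ z, I ^ (i + 1) = Ideal.span {z} * I ^ i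
  · exact Or.inl hred
  right
  have hfin := length_quotient_pow_mul_pow_ne_top hN i
  have hstep (j : ℕ) : (maximalIdeal R ^ (j + 1) * I ^ i).colength + 2 ≤
      (maximalIdeal R ^ (j + 1 + 1) * I ^ i).colength := by
    by_contra hlt
    apply hprin
    have e : maximalIdeal R ^ (j + 1 + 1) * I ^ i =
        maximalIdeal R * (maximalIdeal R ^ (j + 1) * I ^ i) := by
      rw [pow_succ' _ (j + 1), mul_assoc]
    obtain ⟨y, hy⟩ := Ideal.exists_eq_span_singleton_of_colength_le
      (J := maximalIdeal R ^ (j + 1) * I ^ i) (e ▸ hfin (j + 1 + 1)) (by rw [← e]; omega)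
    have hyreg : y ∈ nonZeroDivisors R :=
      mem_nonZeroDivisors_of_mem_of_le_span (mul_mem (pow_mem hx (j + 1)) (pow_mem hx i))
        (Ideal.mul_mem_mul (Ideal.pow_mem_pow hxm _) (Ideal.pow_mem_pow hxI _)) hy.le
    rw [pow_succ', mul_assoc] at hy
    exact exists_maximalIdeal_eq_span_of_mul_eq_span hyreg hy
  have hfirst : (I ^ i).colength + i + 1 ≤ (maximalIdeal R * I ^ i).colength := by
    by_contra hlt
    have hfin1 : Module.length R (R ⧸ (maximalIdeal R * I ^ i)) ≠ ⊤ := by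
      have h := hfin 1
      rwa [pow_one] at h
    -- For `i = 0` the claim is only `𝔪 ≠ R`. For positive exponent, failure bounds the number of
    -- generators as Eakin–Sathaye requires, and the resulting relation is multiplied once by `I`.
    rcases i with _ | i
    · have h1 : maximalIdeal R * I ^ 0 < I ^ 0 := by
        simpa [lt_top_iff_ne_top] using Ideal.IsPrime.ne_top'
      have := Ideal.colength_lt_of_lt h1 hfin1
      omega
    · obtain ⟨z, -, hz⟩ := exists_pow_succ_eq_span_singleton_mul hfin1 (by omega)
      exact hred ⟨z, by rw [pow_succ', hz, mul_left_comm, ← pow_succ', hz]⟩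
  have hall (j : ℕ) : (I ^ i).colength + i + 1 + 2 * j ≤
      (maximalIdeal R ^ (j + 1) * I ^ i).colength := by
    induction j with
    | zero => simpa using hfirst
    | succ j ih =>
      have := hstep j
      omega
  obtain ⟨j, rfl⟩ : ∃ j, k = j + 2 := ⟨k - 2, by omega⟩
  have h1 := hall (j + 1)
  have h2 : (maximalIdeal R ^ (j + 1 + 1) * I ^ i).colength ≤ (I ^ (i + 1)).colength := by
    refine Ideal.colength_le_of_le ?_ (length_quotient_pow_ne_top hN _)
    rw [pow_succ']
    gcongr
  -- The filtration gives `i + 1 + 2(k - 1)`, which is at least `i + k + 1` exactly because `k ≥ 2`.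
  omega

theorem le_choose_two_of_colength_pow_eq [Infinite (ResidueField R)] {I : Ideal R} {N : ℕ}
    (hN : maximalIdeal R ^ N ≤ I) {x : R} (hx : x ∈ nonZeroDivisors R) (hxI : x ∈ I)
    {k : ℕ} (hk : 2 ≤ k) (hIk : I ≤ maximalIdeal R ^ k) {e₀ e₁ : ℤ} {n₀ : ℕ}
    (h : ∀ n ≥ n₀, ((I ^ (n + 1)).colength : ℤ) = e₀ * (n + 1) - e₁) :
    e₁ ≤ Ring.choose (e₀ - k) 2 := by
  have hH (i : ℕ) : e₀ - ((I ^ (i + 1)).colength - (I ^ i).colength : ℤ) ≤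
      max 0 (e₀ - k - 1 - i) := by
    rcases exists_span_mul_or_le_colength hN hx hxI hk hIk i with ⟨z, hz⟩ | hle
    · apply le_max_of_le_left
      -- The shift by `n₀ + 1` reaches the range of the Hilbert polynomial, where consecutive
      -- colengths differ by `e₀`.
      have h1 := colength_pow_succ_sub_of_eq_span_mul hN hx hxI hz (n₀ + 1)
      have h2 := h (i + n₀) (by omega)
      have h3 := h (i + n₀ + 1) (by omega)
      rw [show i + (n₀ + 1) = i + n₀ + 1 by ring] at h1
      rw [← h1, h2, h3]
      push_cast
      apply le_of_eq
      ring
    · apply le_max_of_le_right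
      have : ((I ^ i).colength : ℤ) + i + k + 1 ≤ (I ^ (i + 1)).colength := by exact_mod_cast hle
      linarith
  have h0 : ((I ^ 0).colength : ℤ) = 0 := by
    rw [pow_zero, Ideal.one_eq_top, Ideal.colength]
    have : Subsingleton (R ⧸ (⊤ : Ideal R)) := Ideal.Quotient.subsingleton_iff.mpr rfl
    simp
  calc e₁ = e₀ * (n₀ + 1) - (I ^ (n₀ + 1)).colength := by rw [h n₀ le_rfl]; ring
    _ = ∑ i ∈ Finset.range (n₀ + 1),
          (e₀ - ((I ^ (i + 1)).colength - (I ^ i).colength : ℤ)) := by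
      rw [Finset.sum_sub_distrib, Finset.sum_range_sub (fun i => ((I ^ i).colength : ℤ)), h0]
      simp [mul_comm]
    _ ≤ ∑ i ∈ Finset.range (n₀ + 1), max 0 (e₀ - k - 1 - i) :=
      Finset.sum_le_sum fun i _ => hH i
    _ ≤ _ := sum_max_zero_le_choose_two _ _

end DimensionOne

/-! ### Superficial elements -/

section Superficial

open IsLocalRing

/-- Superficiality controls only those `b` already in `I^c`. Artin–Rees and the regularity of `x`
place every `b` with `x b ∈ I^(n+1)` in `I^(n+1-k)`, hence in `I^c` for large `n`. -/
theorem comap_mulLeft_pow_succ_eq_of_superficial {R : Type*} [CommRing R] [IsNoetherianRing R]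
    {I : Ideal R} {x : R} (hxI : x ∈ I)
    (hx : x ∈ nonZeroDivisors R)
    {c : ℕ} (hc : ∀ n ≥ c, ∀ b ∈ I ^ n, x * b ∈ I ^ (n + 2) → b ∈ I ^ (n + 1)) :
    ∃ n₀, ∀ n ≥ n₀, Submodule.comap (LinearMap.mulLeft R x) (I ^ (n + 1)) = I ^ n := by
  have key (s : ℕ) (b : R) (hb : b ∈ I ^ c) (hxb : x * b ∈ I ^ (c + s + 1)) : b ∈ I ^ (c + s) := by
    induction s with
    | zero => exact hb
    | succ s ih =>
      exact hc (c + s) (by omega) b (ih (Ideal.pow_le_pow_right (by omega) hxb)) hxb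
  obtain ⟨k, hk⟩ := Ideal.exists_pow_inf_eq_pow_smul I (Ideal.span {x})
  refine ⟨k + c, fun n hn => le_antisymm (fun b hb => ?_) (fun b hb => ?_)⟩
  · rw [Submodule.mem_comap, LinearMap.mulLeft_apply] at hb
    have h1 : x * b ∈ I ^ (n + 1) • (⊤ : Ideal R) ⊓ Ideal.span {x} :=
      ⟨by simpa using hb, Ideal.mul_mem_right _ _ (Ideal.mem_span_singleton_self x)⟩
    rw [hk (n + 1) (by omega)] at h1
    have h2 : x * b ∈ I ^ (n + 1 - k) * Ideal.span {x} := Ideal.mul_mono_right inf_le_right h1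
    rw [mul_comm, Ideal.mem_span_singleton_mul] at h2
    obtain ⟨y, hy, e⟩ := h2
    rw [mul_cancel_left_mem_nonZeroDivisors hx] at e
    subst e
    obtain ⟨s, rfl⟩ : ∃ s, n = c + s := ⟨n - c, by omega⟩
    exact key s y (Ideal.pow_le_pow_right (by omega) hy) hb
  · rw [Submodule.mem_comap, LinearMap.mulLeft_apply, pow_succ']
    exact Ideal.mul_mem_mul hxI hb

variable {R : Type*} [CommRing R] [IsLocalRing R]

/-- A finitely generated module over a local ring with infinite residue field is not the union of
finitely many proper submodules. -/
theorem exists_forall_notMem_of_ne_top [Infinite (ResidueField R)] {M : Type*} [AddCommGroup M]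
    [Module R M] [Module.Finite R M] (S : Set (Submodule R M)) (hS : S.Finite)
    (h : ∀ P ∈ S, P ≠ ⊤) : ∃ x : M, ∀ P ∈ S, x ∉ P := by
  classical
  let mM : Submodule R M := maximalIdeal R • ⊤
  let : Field (R ⧸ maximalIdeal R) := Ideal.Quotient.field _
  have : Infinite (R ⧸ maximalIdeal R) := ‹Infinite (ResidueField R)›
  let g (P : Submodule R M) : Submodule (R ⧸ maximalIdeal R) (M ⧸ mM) :=
    { carrier := P.map mM.mkQ
      add_mem' := fun ha hb => add_mem ha hb
      zero_mem' := zero_mem _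
      smul_mem' := fun c x hx => by
        obtain ⟨r, rfl⟩ := Ideal.Quotient.mk_surjective c
        exact (P.map mM.mkQ).smul_mem r hx }
  -- By Nakayama proper submodules stay proper modulo `𝔪 M`, where a vector space over an infinite
  -- field is not a finite union of proper subspaces.
  have hg (P : Submodule R M) (hP : g P = ⊤) : P = ⊤ := by
    have h1 : P.map mM.mkQ = ⊤ := by
      rw [eq_top_iff]
      intro y _
      have : y ∈ g P := hP ▸ Submodule.mem_top
      exact this
    have h2 : P ⊔ mM = ⊤ := by
      have h3 := congrArg (Submodule.comap mM.mkQ) h1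
      rwa [Submodule.comap_map_mkQ, Submodule.comap_top, sup_comm] at h3
    exact top_le_iff.mp (Submodule.le_of_le_smul_of_le_jacobson_bot Module.Finite.fg_top
      (jacobson_eq_maximalIdeal ⊥ bot_ne_top).ge h2.ge)
  have hne := Subspace.biUnion_ne_univ_of_top_notMem (s := hS.toFinset.image g) (by
    rw [Finset.mem_image]
    rintro ⟨P, hP, e⟩
    exact h P (hS.mem_toFinset.mp hP) (hg P e))
  obtain ⟨y, hy⟩ := (Set.ne_univ_iff_exists_notMem _).mp hne
  obtain ⟨x, rfl⟩ := mM.mkQ_surjective y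
  refine ⟨x, fun P hP hx => hy ?_⟩
  simp only [Set.mem_iUnion]
  exact ⟨g P, Finset.mem_image_of_mem g (hS.mem_toFinset.mpr hP), Submodule.mem_map_of_mem hx⟩

variable [IsNoetherianRing R] [Infinite (ResidueField R)]

/-- Existence of a superficial element outside of finitely many ideals. -/
theorem exists_superficial (I : Ideal R) (S : Set (Ideal R)) (hS : S.Finite)
    (h : ∀ P ∈ S, ¬ I ≤ P) : ∃ x ∈ I, (∀ P ∈ S, x ∉ P) ∧
      ∃ c, ∀ n ≥ c, ∀ b ∈ I ^ n, x * b ∈ I ^ (n + 2) → b ∈ I ^ (n + 1) := by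
  classical
  -- The degree-`n` part of `J` is `I^(n+1) t^n`, so superficiality of `x` means that `x t` is
  -- cancellable modulo `J` in large degrees. This is checked on each component of a primary
  -- decomposition of `J`.
  let J : Ideal (reesAlgebra I) := I.map (algebraMap R (reesAlgebra I))
  obtain ⟨t, ht, htp⟩ := Submodule.isLasker (reesAlgebra I) (reesAlgebra I) J
  let W (Q : Ideal (reesAlgebra I)) : Submodule R ↥(I ^ 1) :=
    (Q.radical.restrictScalars R).comap (reesAlgebraMonomial I 1)
  let W' (P : Ideal R) : Submodule R ↥(I ^ 1) := Submodule.comap (I ^ 1).subtype P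
  -- Components whose radical contains all of degree one cannot be avoided and are discarded; they
  -- contain everything of large degree, so they impose no condition there.
  obtain ⟨⟨x, hx⟩, hxW⟩ := exists_forall_notMem_of_ne_top
    ((W '' t) \ {⊤} ∪ W' '' S) ((t.finite_toSet.image W).sdiff.union (hS.image W')) (by
      rintro P (⟨-, hP⟩ | ⟨P, hP, rfl⟩)
      · exact hP
      · intro he
        apply h P hP
        intro a ha
        have : (⟨a, by simpa using ha⟩ : ↥(I ^ 1)) ∈ W' P := he ▸ Submodule.mem_top
        exact this)
  refine ⟨x, by simpa using hx, fun P hP hxP => hxW (W' P) (Or.inr ⟨P, hP, rfl⟩) hxP, ?_⟩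
  have hex (Q : Ideal (reesAlgebra I)) : ∃ c : ℕ, Q ∈ t → ∀ n ≥ c, ∀ b : ↥(I ^ n),
      reesAlgebraMonomial I 1 ⟨x, hx⟩ * reesAlgebraMonomial I n b ∈ Q →
        reesAlgebraMonomial I n b ∈ Q := by
    by_cases hQ : Q ∈ t
    swap
    · exact ⟨0, fun h => absurd h hQ⟩
    by_cases hW : W Q = ⊤
    · obtain ⟨c, hc⟩ := Ideal.exists_pow_le_of_le_radical_of_fg (I := Q.radical) le_rfl
        (IsNoetherian.noetherian _)
      refine ⟨c, fun _ n hn b _ => hc (Ideal.pow_le_pow_right hn ?_)⟩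
      refine reesAlgebraMonomial_mem_pow (fun a => ?_) n b
      have : a ∈ W Q := hW ▸ Submodule.mem_top
      exact this
    · refine ⟨0, fun _ n _ b hb => ?_⟩
      rw [mul_comm] at hb
      refine ((Ideal.isPrimary_iff.mp (htp hQ)).2 hb).resolve_right fun hrad => ?_
      exact hxW (W Q) (Or.inl ⟨⟨Q, hQ, rfl⟩, hW⟩) hrad
  choose c hc using hex
  refine ⟨t.sup c, fun n hn b hb hxb => ?_⟩
  have h1 : reesAlgebraMonomial I 1 ⟨x, hx⟩ * reesAlgebraMonomial I n ⟨b, hb⟩ ∈ J := by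
    rw [reesAlgebraMonomial_mul (add_comm 1 n)]
    refine reesAlgebraMonomial_mem_map ?_
    rwa [← pow_succ']
  have h2 : reesAlgebraMonomial I n ⟨b, hb⟩ ∈ J := by
    rw [← ht, Submodule.mem_finsetInf] at h1 ⊢
    exact fun Q hQ => hc Q hQ n ((Finset.le_sup hQ).trans hn) _ (h1 Q hQ)
  rw [pow_succ']
  exact mem_of_reesAlgebraMonomial_mem_map h2

open RingTheory.Sequence Pointwise in
/-- An element of an `𝔪`-primary ideal that is superficial, regular and reduces a maximal regular
sequence of the ring to a regular sequence of the quotient. -/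
theorem exists_superficial_isRegular {I : Ideal R} {N : ℕ} (hN : maximalIdeal R ^ N ≤ I)
    (hI : I ≤ maximalIdeal R) {d : ℕ} {rs : List R} (hm : ∀ r ∈ rs, r ∈ maximalIdeal R)
    (hrs : IsRegular R rs) (hd : rs.length = d + 1) :
    ∃ x ∈ I, x ∈ nonZeroDivisors R ∧
      (∃ n₀, ∀ n ≥ n₀, Submodule.comap (LinearMap.mulLeft R x) (I ^ (n + 1)) = I ^ n) ∧
      ∃ rs' : List R, (∀ r ∈ rs', r ∈ maximalIdeal R) ∧ rs'.length = d ∧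
        IsWeaklyRegular (R ⧸ Ideal.span {x}) (rs'.map (Ideal.Quotient.mk (Ideal.span {x}))) := by
  obtain ⟨rs', a, rfl⟩ : ∃ rs' a, rs = rs' ++ [a] := by
    rcases List.eq_nil_or_concat rs with rfl | ⟨L, b, rfl⟩
    · simp at hd
    · exact ⟨L, b, by simp⟩
  have hw := (isWeaklyRegular_append_iff R rs' [a]).mp hrs.toIsWeaklyRegular
  let M := R ⧸ (Ideal.ofList rs' • ⊤ : Submodule R R)
  have ha : IsSMulRegular M a := (isWeaklyRegular_singleton_iff M a).mp hw.2
  -- An associated prime of `M` containing `I` would contain `𝔪`, hence `a`, which is regular on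
  -- `M`. So `x` can avoid all of them and replace `a` as last term of the sequence.
  obtain ⟨x, hxI, hxP, c, hc⟩ := exists_superficial I (associatedPrimes R M)
    (associatedPrimes.finite R M) (by
      intro P hP hle
      have hprime : P.IsPrime := hP.isPrime
      have hmP : maximalIdeal R ≤ P := hprime.le_of_pow_le (hN.trans hle)
      have h1 : a ∈ ⋃ p ∈ associatedPrimes R M, (p : Set R) :=
        Set.mem_biUnion hP (hmP (hm a (by simp)))
      rw [biUnion_associatedPrimes_eq_compl_regular] at h1
      exact h1 ha)
  have hxreg : IsSMulRegular M x := by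
    by_contra hcon
    have h1 : x ∈ {r : R | IsSMulRegular M r}ᶜ := hcon
    rw [← biUnion_associatedPrimes_eq_compl_regular] at h1
    obtain ⟨P, hP, hxP'⟩ := Set.mem_iUnion₂.mp h1
    exact hxP P hP hxP'
  have hm' : ∀ r ∈ rs', r ∈ maximalIdeal R := fun r hr => hm r (by simp [hr])
  have h1 : IsRegular R (rs' ++ [x]) := by
    rw [IsLocalRing.isRegular_iff_isWeaklyRegular_of_subset_maximalIdeal, isWeaklyRegular_append_iff,
      isWeaklyRegular_singleton_iff]
    · exact ⟨hw.1, hxreg⟩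
    · intro r hr
      rcases List.mem_append.mp hr with hr | hr
      · exact hm' r hr
      · rw [List.mem_singleton.mp hr]
        exact hI hxI
  -- Regular sequences in a Noetherian local ring may be permuted, so `x` moves to the front.
  have h2 := (isRegular_cons_iff R x rs').mp
    (isRegular_of_perm h1 (List.perm_append_singleton x rs'))
  have hx0 : x ∈ nonZeroDivisors R := by
    rw [mem_nonZeroDivisors_iff_right]
    intro y hy
    exact h2.1 (by simpa [mul_comm] using hy)
  refine ⟨x, hxI, hx0, comap_mulLeft_pow_succ_eq_of_superficial hxI hx0 hc, rs', hm', ?_, ?_⟩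
  · simpa using hd
  · have e : (x • ⊤ : Submodule R R) = Ideal.span {x} := by
      rw [← Submodule.ideal_span_singleton_smul, smul_eq_mul, Ideal.mul_top]
    have h3 := ((Submodule.quotEquivOfEq _ _ e).isWeaklyRegular_congr rs').mp h2.2.toIsWeaklyRegular
    exact (isWeaklyRegular_map_algebraMap_iff (R ⧸ Ideal.span {x}) _ rs').mpr h3

end Superficial

/-! ### Existence of the coefficients and induction on the dimension -/

section HilbertCoefficients

open IsLocalRing

universe u

/-- Discrete integration: by Pascal's rule the difference of the new binomial sum is the old one.
The constant of integration will be the new last coefficient, up to sign. -/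
theorem exists_eq_sum_choose_add_const {f : ℕ → ℤ} {c : ℕ → ℤ} {d N : ℕ}
    (h : ∀ n ≥ N, f (n + 1) = f n +
      ∑ j ∈ Finset.range (d + 1), c j * (Nat.choose (n + 1 + d - j) (d - j) : ℤ)) :
    ∃ D : ℤ, ∀ n ≥ N, f n =
      ∑ j ∈ Finset.range (d + 1), c j * (Nat.choose (n + (d + 1) - j) (d + 1 - j) : ℤ) + D := by
  refine ⟨f N - ∑ j ∈ Finset.range (d + 1),
    c j * (Nat.choose (N + (d + 1) - j) (d + 1 - j) : ℤ), fun n hn => ?_⟩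
  induction n, hn using Nat.le_induction with
  | base => ring
  | succ n hn ih =>
    have h3 : ∑ j ∈ Finset.range (d + 1),
        c j * (Nat.choose (n + 1 + (d + 1) - j) (d + 1 - j) : ℤ) =
        ∑ j ∈ Finset.range (d + 1), c j * (Nat.choose (n + 1 + d - j) (d - j) : ℤ) +
        ∑ j ∈ Finset.range (d + 1), c j * (Nat.choose (n + (d + 1) - j) (d + 1 - j) : ℤ) := by
      rw [← Finset.sum_add_distrib]
      refine Finset.sum_congr rfl fun j hj => ?_
      have hj' := Finset.mem_range.mp hj
      have e1 : n + 1 + (d + 1) - j = (n + 1 + d - j) + 1 := by omega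
      have e2 : d + 1 - j = (d - j) + 1 := by omega
      have e3 : n + (d + 1) - j = n + 1 + d - j := by omega
      rw [e1, e2, e3, Nat.choose_succ_succ']
      push_cast
      ring
    rw [h n hn, h3]
    linarith

variable {R : Type u} [CommRing R]

theorem length_quotient_map_mk_eq (x : R) (J : Ideal R) :
    Module.length (R ⧸ Ideal.span {x})
        ((R ⧸ Ideal.span {x}) ⧸ J.map (Ideal.Quotient.mk (Ideal.span {x}))) =
      Module.length R (R ⧸ (J ⊔ Ideal.span {x})) := by
  rw [← Module.length_eq_of_surjective (S := R) (R := R ⧸ Ideal.span {x})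
    Ideal.Quotient.mk_surjective, sup_comm]
  exact (DoubleQuot.quotQuotEquivQuotSupₐ R (Ideal.span {x}) J).toLinearEquiv.length_eq

variable [IsLocalRing R] [IsNoetherianRing R]

/-- Lifting Hilbert coefficients from the quotient by a superficial regular element. -/
theorem exists_isHilbertCoefficients_of_quotient {I : Ideal R} {N : ℕ}
    (hN : maximalIdeal R ^ N ≤ I) {x : R} {n₀ d : ℕ}
    (hx : ∀ n ≥ n₀, Submodule.comap (LinearMap.mulLeft R x) (I ^ (n + 1)) = I ^ n)
    (hR : ringKrullDim R = (d + 1 : ℕ)) (hRx : ringKrullDim (R ⧸ Ideal.span {x}) = d)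
    {e' : ℕ → ℤ} (he' : IsHilbertCoefficients (I.map (Ideal.Quotient.mk (Ideal.span {x}))) e') :
    ∃ e, IsHilbertCoefficients I e ∧ ∀ j ≤ d, e j = e' j := by
  obtain ⟨d', hd', hev, -⟩ := he'
  obtain rfl : d = d' := by
    rw [hRx] at hd'
    exact_mod_cast hd'
  obtain ⟨n₁, hn₁⟩ := Filter.eventually_atTop.mp hev
  have hfin := length_quotient_pow_ne_top hN
  obtain ⟨D, hD⟩ := exists_eq_sum_choose_add_const (f := fun n => ((I ^ (n + 1)).colength : ℤ))
    (c := fun j => (-1) ^ j * e' j) (d := d) (N := max n₀ n₁) (by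
      intro n hn
      obtain ⟨l, hl, hle⟩ := hn₁ (n + 1) (by omega)
      -- Since `I^(n+2) : x = I^(n+1)`, the Hilbert function of the quotient ring is the difference
      -- of consecutive colengths in `R`.
      rw [← hle, Ideal.colength_eq_comap_add (hfin (n + 1 + 1)) x, hx (n + 1) (by omega)]
      push_cast
      congr 2
      rw [← Ideal.map_pow, length_quotient_map_mk_eq] at hl
      rw [Ideal.colength, hl, ENat.toNat_natCast])
  refine ⟨fun j => if j ≤ d then e' j else if j = d + 1 then (-1) ^ (d + 1) * D else 0,
    ⟨d + 1, hR, ?_, ?_⟩, fun j hj => if_pos hj⟩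
  · filter_upwards [Filter.eventually_ge_atTop (max n₀ n₁)] with n hn
    refine ⟨(I ^ (n + 1)).colength, (Ideal.coe_colength (hfin _)).symm, ?_⟩
    rw [hD n hn, Finset.sum_range_succ _ (d + 1)]
    congr 1
    · refine Finset.sum_congr rfl fun j hj => ?_
      rw [if_pos (by have := Finset.mem_range.mp hj; omega)]
    · rw [if_neg (by omega), if_pos rfl, Nat.sub_self, Nat.choose_zero_right, ← mul_assoc,
        ← pow_add, Even.neg_one_pow ⟨d + 1, rfl⟩]
      simp
  · intro j hj
    simp only
    rw [if_neg (by omega), if_neg (by omega)]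

theorem exists_isHilbertCoefficients_of_ringKrullDim_eq_zero {I : Ideal R}
    (hI : I ≤ maximalIdeal R) (hR : ringKrullDim R = 0) : ∃ e, IsHilbertCoefficients I e := by
  have hdim : Ring.KrullDimLE 0 R := Ring.krullDimLE_iff.mpr (by simp [hR])
  have hart : IsArtinianRing R := isArtinianRing_iff_krullDimLE_zero.mpr hdim
  obtain ⟨r, hr⟩ := (isArtinianRing_iff_isNilpotent_maximalIdeal R).mp hart
  have hfin : Module.length R (R ⧸ (⊥ : Ideal R)) ≠ ⊤ := Ideal.length_quotient_ne_top (hr.le)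
  refine ⟨fun j => if j = 0 then (⊥ : Ideal R).colength else 0, 0, by simp [hR], ?_, ?_⟩
  · filter_upwards [Filter.eventually_ge_atTop r] with n hn
    have hbot : I ^ (n + 1) = ⊥ := le_bot_iff.mp <|
      (Ideal.pow_right_mono hI _).trans ((Ideal.pow_le_pow_right (by omega)).trans hr.le)
    rw [hbot]
    exact ⟨_, (Ideal.coe_colength hfin).symm, by simp⟩
  · intro j hj
    simp [hj.ne']

open RingTheory.Sequence in
/-- The Hilbert coefficients of an `𝔪`-primary ideal of a Cohen–Macaulay local ring exist, and
satisfy `e₁ ≤ binom (e₀ - k) 2` if the dimension is positive and the ideal lies in `𝔪 ^ k`. -/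
theorem exists_isHilbertCoefficients_and_le (d : ℕ) : ∀ (R : Type u) [CommRing R] [IsLocalRing R]
    [IsNoetherianRing R] [Infinite (ResidueField R)] (rs : List R)
    (_ : ∀ r ∈ rs, r ∈ maximalIdeal R) (_ : IsRegular R rs) (_ : rs.length = d)
    (_ : ringKrullDim R = d) (I : Ideal R) (N : ℕ) (_ : maximalIdeal R ^ N ≤ I)
    (_ : I ≤ maximalIdeal R), ∃ e, IsHilbertCoefficients I e ∧
      (1 ≤ d → ∀ k : ℕ, 2 ≤ k → I ≤ maximalIdeal R ^ k → e 1 ≤ Ring.choose (e 0 - k) 2) := by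
  induction d with
  | zero =>
    intro R _ _ _ _ rs _ _ _ hdim I N _ hI
    obtain ⟨e, he⟩ := exists_isHilbertCoefficients_of_ringKrullDim_eq_zero hI (by simpa using hdim)
    exact ⟨e, he, by simp⟩
  | succ d ih =>
    intro R _ _ _ _ rs hm hrs hlen hdim I N hN hI
    obtain ⟨x, hxI, hx, ⟨n₀, hn₀⟩, rs', hm', hlen', hw⟩ :=
      exists_superficial_isRegular hN hI hm hrs hlen
    let φ := Ideal.Quotient.mk (Ideal.span {x})
    have hφ : Function.Surjective φ := Ideal.Quotient.mk_surjective
    have hxm : x ∈ maximalIdeal R := hI hxI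
    have : Nontrivial (R ⧸ Ideal.span {x}) := by
      refine Ideal.Quotient.nontrivial_iff.mpr fun htop => ?_
      have h1 := htop.ge.trans ((Ideal.span_singleton_le_iff_mem _).mpr hxm)
      exact Ideal.IsPrime.ne_top' (top_le_iff.mp h1)
    have : IsLocalRing (R ⧸ Ideal.span {x}) := .of_surjective' φ hφ
    have : IsLocalHom φ := .of_surjective φ hφ
    have : Infinite (ResidueField (R ⧸ Ideal.span {x})) :=
      Infinite.of_injective _ (ResidueField.map φ).injective
    have hmax : (maximalIdeal R).map φ = maximalIdeal (R ⧸ Ideal.span {x}) :=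
      map_maximalIdeal_of_surjective φ hφ
    have hmem (r : R) (hr : r ∈ maximalIdeal R) : φ r ∈ maximalIdeal (R ⧸ Ideal.span {x}) :=
      hmax ▸ Ideal.mem_map_of_mem φ hr
    have hdim' : ringKrullDim (R ⧸ Ideal.span {x}) = d := by
      have h1 := ringKrullDim_quotient_span_singleton_succ_eq_ringKrullDim_of_mem_nonZeroDivisors
        hx hxm
      rw [hdim, Nat.cast_add, Nat.cast_one] at h1
      exact ENat.WithBot.add_one_cancel.mp h1
    have hms : ∀ r ∈ rs'.map φ, r ∈ maximalIdeal (R ⧸ Ideal.span {x}) := by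
      intro r hr
      obtain ⟨a, ha, rfl⟩ := List.mem_map.mp hr
      exact hmem a (hm' a ha)
    obtain ⟨e', he', hle'⟩ := ih (R ⧸ Ideal.span {x}) (rs'.map φ) hms
      ((isRegular_iff_isWeaklyRegular_of_subset_maximalIdeal hms).mpr hw) (by simpa using hlen')
      hdim' (I.map φ) N (by rw [← hmax, ← Ideal.map_pow]; exact Ideal.map_mono hN)
      (by rw [← hmax]; exact Ideal.map_mono hI)
    obtain ⟨e, he, hee⟩ := exists_isHilbertCoefficients_of_quotient hN hn₀ hdim hdim' he'
    refine ⟨e, he, fun _ k hk hIk => ?_⟩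
    -- Passing to a quotient of dimension zero loses `e₁`, so dimension one is treated in `R`
    -- itself; otherwise `e₀` and `e₁` both come from the quotient.
    rcases Nat.eq_zero_or_pos d with rfl | hd
    · obtain ⟨d', hd', hev, -⟩ := he
      obtain rfl : 1 = d' := by
        rw [hdim] at hd'
        exact_mod_cast hd'
      obtain ⟨n₁, hn₁⟩ := Filter.eventually_atTop.mp hev
      refine le_choose_two_of_colength_pow_eq hN hx hxI hk hIk (n₀ := n₁) fun n hn => ?_
      obtain ⟨l, hl, hle⟩ := hn₁ n hn
      rw [Ideal.colength, hl, ENat.toNat_natCast, hle]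
      simp [Finset.sum_range_succ]
      ring
    · rw [hee 0 (by omega), hee 1 (by omega)]
      refine hle' hd k hk ?_
      rw [← hmax, ← Ideal.map_pow]
      exact Ideal.map_mono hIk

end HilbertCoefficients

theorem corollary3p7 {R : Type*} [CommRing R] [IsLocalRing R] [IsNoetherianRing R]
    (hCM : IsCohenMacaulayLocal R) [Infinite (IsLocalRing.ResidueField R)]
    (hdim : 1 ≤ ringKrullDim R)
    (I : Ideal R) (hI : I.IsPrimary) (hrad : I.radical = IsLocalRing.maximalIdeal R)
    (k : ℕ) (hk : 2 ≤ k) (hIk : I ≤ IsLocalRing.maximalIdeal R ^ k) :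
    IsHilbertCoefficients I (hilbertCoefficient I) ∧
      hilbertCoefficient I 1 ≤ Ring.choose (hilbertCoefficient I 0 - (k : ℤ)) 2 := by
  obtain ⟨rs, hm, hrs, hlen⟩ := (isCohenMacaulayLocal_iff R).mp hCM
  obtain ⟨N, hN⟩ := Ideal.exists_pow_le_of_le_radical_of_fg hrad.ge
    (IsNoetherian.noetherian (IsLocalRing.maximalIdeal R))
  have hd : 1 ≤ rs.length := by
    rw [← hlen] at hdim
    exact_mod_cast hdim
  obtain ⟨e, he, hle⟩ := exists_isHilbertCoefficients_and_le rs.length R rs hm hrs rfl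
    hlen.symm I N hN (hrad ▸ Ideal.le_radical)
  have heq : hilbertCoefficient I = e := funext he.hilbertCoefficient_eq
  rw [heq]
  exact ⟨he, hle hd k hk hIk⟩
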